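/- Let $S_0,S_1$ be measurable spaces whose singletons are measurable, and let $\mu$ be a measure on $S_0\times S_1$ that is countable in Kingman's sense, i.e. $\mu=\sum_{n\ge1}\mu^{(n)}$ with $\mu^{(n)}(S_0\times S_1)<\infty$ for all $n$. Write $\mu_1(A)=\mu(S_0\times A)$. Let $Z=(X,Y)=\{(X_i,Y_i)\}$ be a Poisson process with mean measure $\mu$: a random countable collection of points of $S_0\times S_1$ (points being counted with multiplicity) such that for disjoint measurable sets $B_1,\dots,B_n$ the counts $\#(Z\cap B_j)$ are independent random variables with $\#(Z\cap B_j)\sim\mathrm{Po}(\mu(B_j))$, where $\mathrm{Po}(\infty)$ is the unit mass at $\infty$. A conditional kernel of $\mu$ is a Markov kernel $\mu(dx\mid y)$ from $S_1$ to $S_0$ with $$\mu(B\times A)=\int_A\mu(B\mid y)\,\mu_1(dy)$$ for all measurable $B\subset S_0$ and all measurable $A\subset S_1$ with $\mu_1(A)<\infty$. (a) If $S_0$ is a non-empty standard Borel space, a conditional kernel of $\mu$ exists. (b) Let $\mu(dx\mid y)$ be any conditional kernel of $\mu$. Let $A\subset S_1$ be measurable with $0<\mu_1(A)<\infty$ and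 let $m\ge0$ be an integer. The event $\#(Y\cap A)=m$ has positive probability. Condition on this event, and let $(X_1,Y_1),\dots,(X_m,Y_m)$ be the points of $Z$ in $S_0\times A$, labelled by a uniform random permutation independent of $Z$ (more precisely: obtained from a measurable labelling of these points by a uniform random permutation of the labels that is independent of $Z$ and of that labelling). Then: 1. the conditional law of $(X_1,\dots,X_m)$ given $(Y_1,\dots,Y_m)=(y_1,\dots,y_m)$ is $\prod_{i=1}^m\mu(dx_i\mid y_i)$; 2. (conditional independence) $X_1,\dots,X_m$ are conditionally independent given $(Y_1,\dots,Y_m)$; 3. (lack of interference) for each $i$, the conditional law of $X_i$ given $(Y_1,\dots,Y_m)$ is $\mu(dx\mid Y_i)$; it depends only on $Y_i$, not on the other events, on their number, or on the test set $A$, since the kernel $\mu(dx\mid y)$ is fixed independently of $A$ and $m$. -/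

import Mathlib

open MeasureTheory ProbabilityTheory Set
open scoped ENNReal NNReal ProbabilityTheory

noncomputable section

/-- The Poisson distribution `Po(r)` on `{0, 1, 2, …, ∞}`, for `r ∈ [0, ∞]`: the usual one if
`r < ∞`, and the unit mass at `∞` if `r = ∞`. -/
def poissonLaw (r : ℝ≥0∞) : Measure ℝ≥0∞ :=
  if r = ∞ then Measure.dirac ∞ else (poissonMeasure r.toNNReal).map (fun n : ℕ => (n : ℝ≥0∞))

/-- `Z ∼ PP(μ)`. The random countable collection of events `Z` is encoded by its counting measure:
`Z ω B = #(Z ∩ B)` is the number of events in `B`, repeated events being counted with their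
multiplicity. A random countable subset is the special case in which the events are distinct. -/
structure IsPoissonProcess {S Ω : Type*} [MeasurableSpace S] [MeasurableSpace Ω]
    (Z : Ω → Measure S) (μ : Measure S) (P : Measure Ω) : Prop where
  /-- `Z` consists of countably many events `z i`, `i ∈ I`, almost surely. -/
  countable_events : ∀ᵐ ω ∂P, ∃ (I : Set ℕ) (z : I → S),
    Z ω = Measure.sum fun i => Measure.dirac (z i)
  /-- The numbers of events in measurable sets are random variables. -/
  measurable_count : ∀ B, MeasurableSet B → Measurable fun ω => Z ω B
  /-- `#(Z ∩ B) ∼ Po(μ(B))`. -/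
  law_count : ∀ B, MeasurableSet B → P.map (fun ω => Z ω B) = poissonLaw (μ B)
  /-- The numbers of events in disjoint sets are independent. -/
  indep_count : ∀ (n : ℕ) (B : Fin n → Set S), (∀ j, MeasurableSet (B j)) →
    Pairwise (fun j k => Disjoint (B j) (B k)) → iIndepFun (fun j ω => Z ω (B j)) P

/-- The kernel `κ y = μ(dx | y) = μ(dx × dy) / μ₁(dy)`: for every measurable `B ⊆ S₀`, the function
`y ↦ κ y B` is a density of `μ(B × dy)` with respect to the marginal `μ₁ = μ.snd`, on every
measurable set of finite `μ₁`-measure. -/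
def IsConditionalKernel {S₀ S₁ : Type*} [MeasurableSpace S₀] [MeasurableSpace S₁]
    (μ : Measure (S₀ × S₁)) (κ : Kernel S₁ S₀) : Prop :=
  ∀ A, MeasurableSet A → μ.snd A < ∞ → ∀ B, MeasurableSet B →
    μ (B ×ˢ A) = ∫⁻ y in A, κ y B ∂μ.snd

/-- The event that exactly `m` points of the projected process `Y` lie in `A`: `#(Y ∩ A) = m`. -/
def observedCount {S₀ S₁ Ω : Type*} [MeasurableSpace S₀] [MeasurableSpace S₁]
    (Z : Ω → Measure (S₀ × S₁)) (A : Set S₁) (m : ℕ) : Set Ω :=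
  {ω | (Z ω).snd A = m}

/-- On the event `#(Y ∩ A) = m`, the events `(X₁, Y₁), …, (Xₘ, Yₘ)` of `Z` with `Yᵢ ∈ A` are labelled
by a uniform random permutation independent of `Z`: there are an initial measurable labelling
`(W₁, …, Wₘ)` of these events and a uniform random permutation `σ`, independent of `Z` and of the
initial labelling, with `(Xᵢ, Yᵢ) = W_{σ(i)}`. -/
def IsUniformLabelling {S₀ S₁ Ω : Type*} [MeasurableSpace S₀] [MeasurableSpace S₁]
    [MeasurableSpace Ω] (P : Measure Ω) (Z : Ω → Measure (S₀ × S₁)) (A : Set S₁) (m : ℕ)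
    (X : Ω → Fin m → S₀) (Y : Ω → Fin m → S₁) : Prop :=
  ∃ (W : Ω → Fin m → S₀ × S₁) (σ : Ω → Equiv.Perm (Fin m)),
    Measurable W ∧
    (∀ᵐ ω ∂P[|observedCount Z A m],
      (Z ω).restrict (Prod.snd ⁻¹' A) = ∑ i, Measure.dirac (W ω i)) ∧
    (∀ τ, MeasurableSet (σ ⁻¹' {τ})) ∧
    (∀ τ, P[|observedCount Z A m] (σ ⁻¹' {τ}) = (m.factorial : ℝ≥0∞)⁻¹) ∧
    Indep (MeasurableSpace.comap σ ⊤)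
      (MeasurableSpace.comap (fun ω => (Z ω, W ω)) inferInstance) P[|observedCount Z A m] ∧
    ∀ ω i, (X ω i, Y ω i) = W ω (σ ω i)

/-- The product kernel `(y₁, …, yₘ) ↦ ∏ᵢ κ(dxᵢ | yᵢ)`. -/
def productKernel {S₀ S₁ : Type*} [MeasurableSpace S₀] [MeasurableSpace S₁]
    (κ : Kernel S₁ S₀) [IsMarkovKernel κ] (m : ℕ) : Kernel (Fin m → S₁) (Fin m → S₀) where
  toFun y := Measure.pi fun i => κ (y i)
  measurable' := by
    refine Measurable.measure_of_isPiSystem_of_isProbabilityMeasure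
      generateFrom_pi.symm isPiSystem_pi ?_
    rintro _ ⟨B, hB, rfl⟩
    simp only [Measure.pi_pi]
    exact Finset.measurable_prod _ fun i _ =>
      (κ.measurable_coe (hB i (mem_univ i))).comp (measurable_pi_apply i)

end

/-! Put `T = S₀ × A`. The core fact is that, given `Z(T) = m`, the randomly labelled points of `T`
are i.i.d. with law `μ(· | T)`. For a finite measurable partition, the cell counts are independent
Poisson variables, hence multinomial given their total. A uniform relabelling produces a prescribed
pattern of cells with probability `∏ nₛ! / m!` once the counts `nₛ` are right, and this cancels the
multinomial coefficient (`measure_cells_eq_prod`). General boxes are unions of such patterns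
(`map_labelled_eq_pi`).

Now `μ(· | T)` is `ν(dy) κ(dx | y)` with `ν = μ₁(· | A)`, and the `m`-fold product of this measure
is `ν^m` followed by `∏ κ(dxᵢ | yᵢ)`. This is the joint conditional law; its marginals give lack of
interference, and its values on boxes give conditional independence.

Existence of `κ` is separate: `μ₁` is only s-finite, so a finite reweighting of its σ-finite part is
disintegrated. -/

/-! ### Counting permutations and Poisson weights -/

/-- The number of permutations carrying `f` to `k`. -/
theorem card_perm_comp_eq {α ι : Type*} [Fintype α] [DecidableEq α] [Fintype ι] [DecidableEq ι]
    (f k : α → ι) :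
    Fintype.card {τ : Equiv.Perm α // f ∘ τ = k} =
      if ∀ s, Fintype.card {a // f a = s} = Fintype.card {a // k a = s}
        then ∏ s, (Fintype.card {a // k a = s}).factorial else 0 := by
  split_ifs with h
  · let e s := Fintype.equivOfCardEq (h s).symm
    let τ₀ : Equiv.Perm α := Equiv.ofFiberEquiv e
    have hτ₀ : f ∘ τ₀ = k := funext fun a => Equiv.ofFiberEquiv_map e a
    -- Since `k = f ∘ τ₀`, left translation by `τ₀⁻¹` carries the solutions onto the stabilizer of
    -- `k`, a product of symmetric groups of fibres.
    rw [← DomMulAct.stabilizer_card k]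
    refine Fintype.card_congr (Equiv.subtypeEquiv (Equiv.mulLeft τ₀⁻¹) fun τ => ?_)
    have : k ∘ (Equiv.mulLeft τ₀⁻¹ τ) = f ∘ τ := by
      rw [← hτ₀]; ext a; simp
    rw [this]
  · rw [Fintype.card_eq_zero_iff]
    refine ⟨fun ⟨τ, hτ⟩ => h fun s => ?_⟩
    subst hτ
    exact (Fintype.card_congr (Equiv.subtypeEquiv τ fun a => Iff.rfl)).symm

theorem poissonLaw_singleton {r : ℝ≥0∞} (hr : r ≠ ∞) (n : ℕ) :
    poissonLaw r {(n : ℝ≥0∞)} =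
      ENNReal.ofReal (Real.exp (-r.toReal) * r.toReal ^ n / n.factorial) := by
  rw [poissonLaw, if_neg hr, Measure.map_apply measurable_from_top (measurableSet_singleton _)]
  have : (fun n : ℕ => (n : ℝ≥0∞)) ⁻¹' {(n : ℝ≥0∞)} = {n} := by ext; simp
  rw [this, poissonMeasure_singleton]
  rfl

/-- The exponentials cancel because the `a s` sum to `l`, and `l ^ ∑ n s` splits over the cells. The
factor `∏ (n s)!` is the number of permutations realising a pattern, so no multinomial coefficient
appears. -/
theorem poisson_multinomial_weight {ι : Type*} [Fintype ι] (a : ι → ℝ) (ha : ∀ s, 0 ≤ a s) {l : ℝ}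
    (hl : 0 < l) (hal : ∑ s, a s = l) (n : ι → ℕ) :
    (ENNReal.ofReal (Real.exp (-l) * l ^ (∑ s, n s) / (∑ s, n s).factorial))⁻¹ *
        (∏ s, ENNReal.ofReal (Real.exp (-a s) * a s ^ n s / (n s).factorial)) *
        ∏ s, ((n s).factorial : ℝ≥0∞) =
      ((∑ s, n s).factorial : ℝ≥0∞) * ∏ s, ENNReal.ofReal (a s / l) ^ n s := by
  have h₁ : ∀ s, 0 ≤ Real.exp (-a s) * a s ^ n s / (n s).factorial := fun s => by
    have := ha s
    positivity
  have h₂ : ∀ s, 0 ≤ a s / l := fun s => div_nonneg (ha s) hl.le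
  simp_rw [← ENNReal.ofReal_pow (h₂ _), ← ENNReal.ofReal_natCast]
  rw [← ENNReal.ofReal_inv_of_pos (by positivity),
    ← ENNReal.ofReal_prod_of_nonneg fun s _ => h₁ s,
    ← ENNReal.ofReal_prod_of_nonneg fun s _ => by positivity,
    ← ENNReal.ofReal_prod_of_nonneg fun s _ => pow_nonneg (h₂ s) _,
    ← ENNReal.ofReal_mul (by positivity),
    ← ENNReal.ofReal_mul (mul_nonneg (by positivity) (Finset.prod_nonneg fun s _ => h₁ s)),
    ← ENNReal.ofReal_mul (by positivity)]
  congr 1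
  have hfac : ∏ s, ((n s).factorial : ℝ) ≠ 0 :=
    Finset.prod_ne_zero_iff.mpr fun s _ => by positivity
  simp_rw [div_pow]
  rw [Finset.prod_div_distrib, Finset.prod_div_distrib, Finset.prod_mul_distrib, ← Real.exp_sum,
    Finset.prod_pow_eq_pow_sum, Finset.sum_neg_distrib, hal]
  field_simp

/-! ### Cell counts given the total -/

namespace IsPoissonProcess

variable {S Ω : Type*} [MeasurableSpace S] [MeasurableSpace Ω] {Z : Ω → Measure S}
  {μ : Measure S} {P : Measure Ω}

theorem measurableSet_count_eq (hZ : IsPoissonProcess Z μ P) {B : Set S} (hB : MeasurableSet B)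
    (n : ℕ) : MeasurableSet {ω | Z ω B = n} :=
  hZ.measurable_count B hB (measurableSet_singleton _)

theorem measure_count_eq (hZ : IsPoissonProcess Z μ P) {B : Set S} (hB : MeasurableSet B)
    (hμB : μ B ≠ ∞) (n : ℕ) :
    P {ω | Z ω B = n} =
      ENNReal.ofReal (Real.exp (-(μ B).toReal) * (μ B).toReal ^ n / n.factorial) := by
  rw [← poissonLaw_singleton hμB, ← hZ.law_count B hB,
    Measure.map_apply (hZ.measurable_count B hB) (measurableSet_singleton _)]
  rfl

theorem measure_count_eq_pos (hZ : IsPoissonProcess Z μ P) {B : Set S} (hB : MeasurableSet B)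
    (hμB₀ : μ B ≠ 0) (hμB : μ B ≠ ∞) (n : ℕ) : 0 < P {ω | Z ω B = n} := by
  rw [hZ.measure_count_eq hB hμB, ENNReal.ofReal_pos]
  have := ENNReal.toReal_pos hμB₀ hμB
  positivity

theorem iIndepFun_count (hZ : IsPoissonProcess Z μ P) {ι : Type*} [Finite ι] (B : ι → Set S)
    (hB : ∀ j, MeasurableSet (B j)) (hd : Pairwise fun j k => Disjoint (B j) (B k)) :
    iIndepFun (fun j ω => Z ω (B j)) P := by
  obtain ⟨n, ⟨e⟩⟩ := Finite.exists_equiv_fin ι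
  have h := hZ.indep_count n (fun j => B (e.symm j)) (fun j => hB _)
    fun j k hjk => hd fun h => hjk (e.symm.injective h)
  have h' := h.precomp e.injective
  simpa using h'

/-- Given the total number of events in `T`, the numbers of events in the cells of a finite partition
of `T` are multinomial. -/
theorem cond_count_eq_mul_prod_factorial (hZ : IsPoissonProcess Z μ P) {T : Set S}
    (hT : MeasurableSet T) (hT₀ : μ T ≠ 0) (hT' : μ T ≠ ∞) {ι : Type*} [Fintype ι] (h : S → ι)
    (hh : ∀ s, MeasurableSet (h ⁻¹' {s})) (n : ι → ℕ) :
    P[|{ω | Z ω T = (∑ s, n s : ℕ)}] {ω | ∀ s, Z ω (h ⁻¹' {s} ∩ T) = n s} *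
        ∏ s, ((n s).factorial : ℝ≥0∞) =
      ((∑ s, n s).factorial : ℝ≥0∞) * ∏ s, μ[|T] (h ⁻¹' {s}) ^ n s := by
  have hsum : ∀ ν : Measure S, ∑ s, ν (h ⁻¹' {s} ∩ T) = ν T := fun ν => by
    simp_rw [← Measure.restrict_apply (μ := ν) (hh _)]
    rw [sum_measure_preimage_singleton _ fun s _ => hh s]
    simp
  have hfin : ∀ s, μ (h ⁻¹' {s} ∩ T) ≠ ∞ := fun s => measure_ne_top_of_subset inter_subset_right hT'
  -- The cell counts determine the total, so conditioning only divides by the probability of the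
  -- total.
  have hsub : {ω | ∀ s, Z ω (h ⁻¹' {s} ∩ T) = n s} ⊆ {ω | Z ω T = (∑ s, n s : ℕ)} := by
    intro ω hω
    simp only [mem_ofPred_eq] at hω ⊢
    simp [← hsum, hω]
  have hjoint : P {ω | ∀ s, Z ω (h ⁻¹' {s} ∩ T) = n s} =
      ∏ s, P {ω | Z ω (h ⁻¹' {s} ∩ T) = n s} := by
    have hi := hZ.iIndepFun_count (fun s => h ⁻¹' {s} ∩ T) (fun s => (hh s).inter hT)
      fun s t hst => Set.disjoint_left.mpr fun x hx hx' => hst (hx.1.symm.trans hx'.1)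
    have := hi.meas_iInter (s := fun s => {ω | Z ω (h ⁻¹' {s} ∩ T) = n s})
      fun s => ⟨{(n s : ℝ≥0∞)}, measurableSet_singleton _, rfl⟩
    rw [← this, ofPred_forall]
  have hcond : ∀ s, μ[|T] (h ⁻¹' {s}) =
      ENNReal.ofReal ((μ (h ⁻¹' {s} ∩ T)).toReal / (μ T).toReal) := fun s => by
    rw [cond_apply hT, inter_comm, ENNReal.ofReal_div_of_pos (ENNReal.toReal_pos hT₀ hT'),
      ENNReal.ofReal_toReal (hfin s), ENNReal.ofReal_toReal hT', div_eq_mul_inv, mul_comm]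
  have hT'' := ENNReal.toReal_pos hT₀ hT'
  have hsumR : ∑ s, (μ (h ⁻¹' {s} ∩ T)).toReal = (μ T).toReal := by
    rw [← ENNReal.toReal_sum fun s _ => hfin s, hsum]
  rw [cond_apply (hZ.measurableSet_count_eq hT _), inter_eq_right.mpr hsub, hjoint,
    hZ.measure_count_eq hT hT']
  simp_rw [hZ.measure_count_eq ((hh _).inter hT) (hfin _), hcond]
  exact poisson_multinomial_weight _ (fun s => ENNReal.toReal_nonneg) hT'' hsumR n

end IsPoissonProcess

/-! ### Uniformly labelled points -/

theorem sum_dirac_preimage_singleton {S ι : Type*} [MeasurableSpace S] {m : ℕ} [DecidableEq ι]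
    (w : Fin m → S) (h : S → ι) {s : ι} (hs : MeasurableSet (h ⁻¹' {s})) :
    (∑ i, Measure.dirac (w i)) (h ⁻¹' {s}) = (Fintype.card {i // h (w i) = s} : ℕ) := by
  rw [Measure.finsetSum_apply, Fintype.card_subtype, Finset.card_filter, Nat.cast_sum]
  refine Finset.sum_congr rfl fun i _ => ?_
  rw [Measure.dirac_apply' _ hs]
  by_cases hi : h (w i) = s <;> simp [hi]

/-- Averaging over a uniform random permutation independent of the labels. -/
theorem measure_forall_comp_perm_eq {S ι Ω : Type*} [MeasurableSpace S] [MeasurableSpace Ω]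
    [DecidableEq ι] {m : ℕ} {Q : Measure Ω} {W : Ω → Fin m → S} (hW : Measurable W)
    {σ : Ω → Equiv.Perm (Fin m)} (hσ : ∀ τ, MeasurableSet (σ ⁻¹' {τ}))
    (hunif : ∀ τ, Q (σ ⁻¹' {τ}) = (m.factorial : ℝ≥0∞)⁻¹)
    (hindep : Indep (MeasurableSpace.comap σ ⊤) (MeasurableSpace.comap W inferInstance) Q)
    (h : S → ι) (hh : ∀ s, MeasurableSet (h ⁻¹' {s})) (k : Fin m → ι) :
    Q {ω | ∀ i, h (W ω (σ ω i)) = k i} =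
      (m.factorial : ℝ≥0∞)⁻¹ *
        ∫⁻ ω, (Fintype.card {τ : Equiv.Perm (Fin m) // (h ∘ W ω) ∘ τ = k} : ℕ) ∂Q := by
  let F : Equiv.Perm (Fin m) → Set (Fin m → S) := fun τ => {w | (h ∘ w) ∘ τ = k}
  have hF : ∀ τ, MeasurableSet (F τ) := fun τ => by
    have : F τ = ⋂ i, (fun w : Fin m → S => w (τ i)) ⁻¹' (h ⁻¹' {k i}) := by
      ext w; simp [F, funext_iff]
    rw [this]
    exact MeasurableSet.iInter fun i => measurable_pi_apply _ (hh _)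
  -- Split by the value of `σ`; by independence each piece contributes `1 / m!` times the
  -- probability of an event in `W` alone.
  have hunion : {ω | ∀ i, h (W ω (σ ω i)) = k i} = ⋃ τ, σ ⁻¹' {τ} ∩ W ⁻¹' F τ := by
    ext ω; simp [F, funext_iff]
  have hcard : ∀ ω, ((Fintype.card {τ : Equiv.Perm (Fin m) // (h ∘ W ω) ∘ τ = k} : ℕ) : ℝ≥0∞) =
      ∑ τ, (W ⁻¹' F τ).indicator 1 ω := fun ω => by
    rw [Fintype.card_subtype, Finset.card_filter, Nat.cast_sum]
    refine Finset.sum_congr rfl fun τ _ => ?_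
    by_cases hτ : (h ∘ W ω) ∘ τ = k <;> simp [indicator, F, hτ]
  rw [hunion, measure_iUnion, tsum_fintype]
  · simp_rw [hcard]
    rw [lintegral_finsetSum _ fun τ _ => measurable_one.indicator (hW (hF τ)), Finset.mul_sum]
    refine Finset.sum_congr rfl fun τ _ => ?_
    rw [lintegral_indicator_one (hW (hF τ)), ← hunif τ]
    exact (Indep_iff _ _ _).mp hindep _ _ ⟨{τ}, trivial, rfl⟩ ⟨F τ, hF τ, rfl⟩
  · exact fun τ τ' hne => Set.disjoint_left.mpr fun ω hω hω' => hne (hω.1.symm.trans hω'.1)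
  · exact fun τ => (hσ τ).inter (hW (hF τ))

theorem measurable_comp_perm {S Ω : Type*} [MeasurableSpace S] [MeasurableSpace Ω] {m : ℕ}
    {W : Ω → Fin m → S} (hW : Measurable W) {σ : Ω → Equiv.Perm (Fin m)}
    (hσ : ∀ τ, MeasurableSet (σ ⁻¹' {τ})) : Measurable fun ω i => W ω (σ ω i) := by
  refine measurable_pi_lambda _ fun i B hB => ?_
  have : (fun ω => W ω (σ ω i)) ⁻¹' B = ⋃ τ, σ ⁻¹' {τ} ∩ (fun ω => W ω (τ i)) ⁻¹' B := by
    ext ω; simp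
  rw [this]
  exact MeasurableSet.iUnion fun τ =>
    (hσ τ).inter (((measurable_pi_apply _).comp hW) hB)

namespace IsPoissonProcess

variable {S Ω : Type*} [MeasurableSpace S] [MeasurableSpace Ω] {Z : Ω → Measure S}
  {μ : Measure S} {P : Measure Ω}

/-- Only the cell counts of `W` matter: the number of permutations producing `k` is `∏ nₛ!` if they
agree with those of `k`, and zero otherwise. The `1 / m!` from `σ` then cancels the `m!` of the
multinomial law. -/
theorem measure_cells_eq_prod (hZ : IsPoissonProcess Z μ P)
    {T : Set S} (hT : MeasurableSet T) (hT₀ : μ T ≠ 0) (hT' : μ T ≠ ∞) {m : ℕ}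
    {W : Ω → Fin m → S} (hW : Measurable W)
    (hZW : ∀ᵐ ω ∂P[|{ω | Z ω T = m}], (Z ω).restrict T = ∑ i, Measure.dirac (W ω i))
    {σ : Ω → Equiv.Perm (Fin m)} (hσ : ∀ τ, MeasurableSet (σ ⁻¹' {τ}))
    (hunif : ∀ τ, P[|{ω | Z ω T = m}] (σ ⁻¹' {τ}) = (m.factorial : ℝ≥0∞)⁻¹)
    (hindep : Indep (MeasurableSpace.comap σ ⊤) (MeasurableSpace.comap W inferInstance)
      P[|{ω | Z ω T = m}])
    {ι : Type*} [Fintype ι] (h : S → ι) (hh : ∀ s, MeasurableSet (h ⁻¹' {s})) (k : Fin m → ι) :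
    P[|{ω | Z ω T = m}] {ω | ∀ i, h (W ω (σ ω i)) = k i} = ∏ i, μ[|T] (h ⁻¹' {k i}) := by
  classical
  rw [measure_forall_comp_perm_eq hW hσ hunif hindep h hh k]
  let n : ι → ℕ := fun s => Fintype.card {i // k i = s}
  have hn : ∑ s, n s = m := by
    rw [← Fintype.card_sigma, Fintype.card_congr (Equiv.sigmaFiberEquiv k), Fintype.card_fin]
  have hE : MeasurableSet {ω | ∀ s, Z ω (h ⁻¹' {s} ∩ T) = n s} := by
    rw [ofPred_forall]
    exact MeasurableSet.iInter fun s => hZ.measurableSet_count_eq ((hh s).inter hT) _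
  have hcard : ∀ᵐ ω ∂P[|{ω | Z ω T = m}],
      ((Fintype.card {τ : Equiv.Perm (Fin m) // (h ∘ W ω) ∘ τ = k} : ℕ) : ℝ≥0∞) =
        {ω | ∀ s, Z ω (h ⁻¹' {s} ∩ T) = n s}.indicator
          (fun _ => ∏ s, ((n s).factorial : ℝ≥0∞)) ω := by
    filter_upwards [hZW] with ω hω
    have hcount : ∀ s, Z ω (h ⁻¹' {s} ∩ T) = (Fintype.card {i // h (W ω i) = s} : ℕ) := fun s => by
      rw [← sum_dirac_preimage_singleton (W ω) h (hh s), ← hω, Measure.restrict_apply (hh s)]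
    rw [card_perm_comp_eq]
    simp only [indicator, mem_ofPred_eq, hcount, Nat.cast_inj, Function.comp_apply, n]
    split_ifs <;> simp
  rw [lintegral_congr_ae hcard, lintegral_indicator_const hE, mul_comm (∏ s, _)]
  have key := hZ.cond_count_eq_mul_prod_factorial hT hT₀ hT' h hh n
  rw [hn] at key
  rw [key, ← mul_assoc, ENNReal.inv_mul_cancel (by positivity) (ENNReal.natCast_ne_top _), one_mul]
  rw [← Finset.prod_fiberwise Finset.univ k]
  refine Finset.prod_congr rfl fun s _ => ?_
  rw [Finset.prod_congr rfl (g := fun _ => μ[|T] (h ⁻¹' {s}))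
    fun i hi => by rw [(Finset.mem_filter.mp hi).2], Finset.prod_const, ← Fintype.card_subtype]

/-- Given their number, the events in `T`, labelled uniformly at random, are independent with law
`μ(· | T)`. -/
theorem map_labelled_eq_pi (hZ : IsPoissonProcess Z μ P)
    {T : Set S} (hT : MeasurableSet T) (hT₀ : μ T ≠ 0) (hT' : μ T ≠ ∞) {m : ℕ}
    {W : Ω → Fin m → S} (hW : Measurable W)
    (hZW : ∀ᵐ ω ∂P[|{ω | Z ω T = m}], (Z ω).restrict T = ∑ i, Measure.dirac (W ω i))
    {σ : Ω → Equiv.Perm (Fin m)} (hσ : ∀ τ, MeasurableSet (σ ⁻¹' {τ}))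
    (hunif : ∀ τ, P[|{ω | Z ω T = m}] (σ ⁻¹' {τ}) = (m.factorial : ℝ≥0∞)⁻¹)
    (hindep : Indep (MeasurableSpace.comap σ ⊤) (MeasurableSpace.comap W inferInstance)
      P[|{ω | Z ω T = m}]) :
    (P[|{ω | Z ω T = m}]).map (fun ω i => W ω (σ ω i)) = Measure.pi fun _ => μ[|T] := by
  classical
  refine (Measure.pi_eq fun C hC => ?_).symm
  have hV := measurable_comp_perm hW hσ
  -- The fibres of `h` are the atoms of the algebra generated by the sides `C i`, so each side is a
  -- finite disjoint union of cells.
  let h : S → Finset (Fin m) := fun z => Finset.univ.filter fun i => z ∈ C i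
  have hh : ∀ s, MeasurableSet (h ⁻¹' {s}) := fun s => by
    have : h ⁻¹' {s} = ⋂ i, {z | z ∈ C i ↔ i ∈ s} := by
      ext z; simp [h, Finset.ext_iff]
    rw [this]
    refine MeasurableSet.iInter fun i => ?_
    by_cases hi : i ∈ s
    · simp only [hi, iff_true]
      exact hC i
    · simp only [hi, iff_false]
      exact (hC i).compl
  have hcell : ∀ (ν : Measure S) i,
      ν (C i) = ∑ s ∈ Finset.univ.filter (fun s : Finset (Fin m) => i ∈ s), ν (h ⁻¹' {s}) :=
    fun ν i => by
      rw [sum_measure_preimage_singleton _ fun s _ => hh s]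
      congr 1
      ext z; simp [h]
  rw [Measure.map_apply hV (MeasurableSet.univ_pi hC)]
  simp_rw [hcell]
  rw [Finset.prod_univ_sum]
  have hunion : (fun ω i => W ω (σ ω i)) ⁻¹' univ.pi C =
      ⋃ k ∈ Fintype.piFinset fun i => Finset.univ.filter fun s : Finset (Fin m) => i ∈ s,
        {ω | ∀ i, h (W ω (σ ω i)) = k i} := by
    ext ω
    simp only [mem_preimage, mem_univ_pi, mem_iUnion, Fintype.mem_piFinset, Finset.mem_filter,
      Finset.mem_univ, true_and, mem_ofPred_eq, exists_prop]
    refine ⟨fun hω => ⟨fun i => h (W ω (σ ω i)), fun i => by simpa [h] using hω i, fun i => rfl⟩, ?_⟩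
    rintro ⟨k, hk, hk'⟩ i
    have := hk i
    rw [← hk' i] at this
    simpa [h] using this
  rw [hunion, measure_biUnion_finset]
  · exact Finset.sum_congr rfl fun k _ =>
      hZ.measure_cells_eq_prod hT hT₀ hT' hW hZW hσ hunif hindep h hh k
  · exact fun k _ k' _ hne => Set.disjoint_left.mpr fun ω hω hω' =>
      hne (funext fun i => (hω i).symm.trans (hω' i))
  · intro k _
    rw [ofPred_forall]
    exact MeasurableSet.iInter fun i => (measurable_pi_iff.mp hV i) (hh (k i))

end IsPoissonProcess

/-! ### Existence of conditional kernels -/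

/-- An s-finite measure on a product with standard Borel first factor has a conditional kernel. -/
theorem exists_isConditionalKernel {S₀ S₁ : Type*} [MeasurableSpace S₀] [MeasurableSpace S₁]
    [StandardBorelSpace S₀] [Nonempty S₀] (μ : Measure (S₀ × S₁)) [SFinite μ] :
    ∃ κ : Kernel S₁ S₀, IsMarkovKernel κ ∧ IsConditionalKernel μ κ := by
  have : SFinite μ.snd := by rw [Measure.snd]; infer_instance
  let E := μ.snd.sigmaFiniteSet
  have hE : MeasurableSet E := measurableSet_sigmaFiniteSet
  -- Weighting by a positive integrable `g` gives a finite measure. As `g` depends on `y` alone, it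
  -- cancels from the disintegration.
  obtain ⟨g, hg₀, hg, hgint⟩ :=
    exists_pos_lintegral_lt_of_sigmaFinite (μ.snd.restrict E) (ε := 1) one_ne_zero
  have hg' : Measurable fun y => (g y : ℝ≥0∞) := hg.coe_nnreal_ennreal
  let μE := μ.restrict (Prod.snd ⁻¹' E)
  have hμE : μE.snd = μ.snd.restrict E := by
    rw [Measure.snd, Measure.snd, Measure.restrict_map measurable_snd hE]
  let ρ := μE.withDensity fun p => (g p.2 : ℝ≥0∞)
  have hρsnd : ρ.snd = (μ.snd.restrict E).withDensity fun y => (g y : ℝ≥0∞) := by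
    ext A hA
    rw [Measure.snd_apply hA, withDensity_apply _ (measurable_snd hA), withDensity_apply _ hA,
      ← hμE, Measure.snd, setLIntegral_map hA hg' measurable_snd]
  have : IsFiniteMeasure ρ := by
    refine ⟨?_⟩
    rw [← Measure.snd_univ, hρsnd, withDensity_apply _ MeasurableSet.univ, Measure.restrict_univ]
    exact hgint.trans ENNReal.one_lt_top
  have hμρ : μE = ρ.withDensity fun p => (g p.2 : ℝ≥0∞)⁻¹ :=
    (withDensity_inv_same (hg'.comp measurable_snd)
      (.of_forall fun p => by simpa using (hg₀ p.2).ne') (.of_forall fun p => by simp)).symm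
  let ρ' := ρ.map Prod.swap
  have : IsFiniteMeasure ρ' := by infer_instance
  have hρ' : ρ'.fst = ρ.snd := by
    rw [Measure.fst, Measure.map_map measurable_fst measurable_swap, Measure.snd]
    rfl
  refine ⟨ρ'.condKernel, inferInstance, fun A hA hAfin B hB => ?_⟩
  -- Off `E` the marginal takes only the values `0` and `∞`, so a set of finite measure lies in `E`
  -- up to a null set.
  have hnull : μ.snd (A \ E) = 0 :=
    (measure_eq_zero_or_top_of_subset_compl_sigmaFiniteSet
      (fun y hy => hy.2)).resolve_right (measure_ne_top_of_subset sdiff_subset hAfin.ne)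
  have hAE : (A ∩ E : Set S₁) =ᵐ[μ.snd] A := by
    rw [← Set.sdiff_sdiff_right_self]
    exact sdiff_null_ae_eq_self hnull
  have hleft : μ (B ×ˢ A) = μE (B ×ˢ A) := by
    rw [Measure.snd_apply (MeasurableSet.diff hA hE)] at hnull
    have hnull' : μ (B ×ˢ A \ Prod.snd ⁻¹' E) = 0 :=
      measure_mono_null (t := Prod.snd ⁻¹' (A \ E)) (fun p hp => ⟨hp.1.2, hp.2⟩) hnull
    rw [Measure.restrict_apply (hB.prod hA),
      ← measure_inter_add_sdiff (B ×ˢ A) (measurable_snd hE : MeasurableSet (Prod.snd ⁻¹' E)), hnull',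
      add_zero]
  have hκ : Measurable fun y => ρ'.condKernel y B := Kernel.measurable_coe _ hB
  calc μ (B ×ˢ A) = ∫⁻ p in B ×ˢ A, (g p.2 : ℝ≥0∞)⁻¹ ∂ρ := by
        rw [hleft, hμρ, withDensity_apply _ (hB.prod hA)]
    _ = ∫⁻ p in A ×ˢ B, (g p.1 : ℝ≥0∞)⁻¹ ∂ρ' := by
        rw [setLIntegral_map (hA.prod hB) (f := fun p => (g p.1 : ℝ≥0∞)⁻¹)
          (hg'.comp measurable_fst).inv measurable_swap]
        simp
    _ = ∫⁻ y in A, (g y : ℝ≥0∞)⁻¹ * ρ'.condKernel y B ∂ρ.snd := by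
        conv_lhs => rw [← ρ'.disintegrate ρ'.condKernel]
        rw [Measure.setLIntegral_compProd (f := fun p => (g p.1 : ℝ≥0∞)⁻¹)
          (hg'.comp measurable_fst).inv hA hB, hρ']
        simp
    _ = ∫⁻ y in A ∩ E, ρ'.condKernel y B ∂μ.snd := by
        rw [hρsnd, restrict_withDensity hA, lintegral_withDensity_eq_lintegral_mul _ hg'
          (g := fun y => (g y : ℝ≥0∞)⁻¹ * ρ'.condKernel y B) (hg'.inv.mul hκ),
          Measure.restrict_restrict hA]
        refine lintegral_congr fun y => ?_
        simp only [Pi.mul_apply]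
        rw [← mul_assoc, ENNReal.mul_inv_cancel (by simpa using (hg₀ y).ne') (by simp), one_mul]
    _ = ∫⁻ y in A, ρ'.condKernel y B ∂μ.snd := setLIntegral_congr hAE

/-! ### Product kernels and conditional distributions -/

theorem lintegral_pi_prod_eq_prod_lintegral {ι : Type*} [Fintype ι] {α : ι → Type*}
    [∀ i, MeasurableSpace (α i)] (ν : ∀ i, Measure (α i)) [∀ i, IsProbabilityMeasure (ν i)]
    {f : ∀ i, α i → ℝ≥0∞} (hf : ∀ i, Measurable (f i)) :
    ∫⁻ y, ∏ i, f i (y i) ∂Measure.pi ν = ∏ i, ∫⁻ y, f i y ∂ν i := by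
  refine (lintegral_prod_eq_prod_lintegral_of_indepFun Finset.univ
    (fun i (y : ∀ i, α i) => f i (y i)) (iIndepFun_pi fun i => (hf i).aemeasurable)
    fun i => (hf i).comp (measurable_pi_apply i)).trans ?_
  exact Finset.prod_congr rfl fun i _ => (measurePreserving_eval ν i).lintegral_comp (hf i)

section

variable {S₀ S₁ : Type*} [MeasurableSpace S₀] [MeasurableSpace S₁]

instance productKernel.instIsMarkovKernel (κ : Kernel S₁ S₀) [IsMarkovKernel κ] (m : ℕ) :
    IsMarkovKernel (productKernel κ m) :=
  ⟨fun y => inferInstanceAs (IsProbabilityMeasure (Measure.pi fun i => κ (y i)))⟩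

theorem productKernel_apply (κ : Kernel S₁ S₀) [IsMarkovKernel κ] (m : ℕ) (y : Fin m → S₁) :
    productKernel κ m y = Measure.pi fun i => κ (y i) := rfl

theorem productKernel_map_eval (κ : Kernel S₁ S₀) [IsMarkovKernel κ] (m : ℕ) (i : Fin m) :
    (productKernel κ m).map (fun x => x i) =
      κ.comap (fun y : Fin m → S₁ => y i) (measurable_pi_apply i) := by
  ext1 y
  rw [Kernel.map_apply _ (measurable_pi_apply i), Kernel.comap_apply, productKernel_apply]
  exact (measurePreserving_eval (fun i => κ (y i)) i).map_eq

/-- Finite measures are determined by rectangles, and on `B ×ˢ A'` the kernel identity applies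
because `A ∩ A'` has finite marginal measure. -/
theorem IsConditionalKernel.cond_eq_map_compProd {μ : Measure (S₀ × S₁)} {κ : Kernel S₁ S₀}
    [IsMarkovKernel κ] (hκ : IsConditionalKernel μ κ) {A : Set S₁} (hA : MeasurableSet A)
    (hA₀ : μ.snd A ≠ 0) (hA' : μ.snd A ≠ ∞) :
    μ[|Prod.snd ⁻¹' A] = (μ.snd[|A] ⊗ₘ κ).map Prod.swap := by
  have hT : MeasurableSet (Prod.snd ⁻¹' A : Set (S₀ × S₁)) := measurable_snd hA
  have hμT : μ (Prod.snd ⁻¹' A) = μ.snd A := (Measure.snd_apply hA).symm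
  have : IsProbabilityMeasure μ.snd[|A] := cond_isProbabilityMeasure_of_finite hA₀ hA'
  have : IsProbabilityMeasure μ[|Prod.snd ⁻¹' A] :=
    cond_isProbabilityMeasure_of_finite (hμT ▸ hA₀) (hμT ▸ hA')
  refine Measure.ext_prod fun {B A'} hB hA'' => ?_
  have hset : Prod.snd ⁻¹' A ∩ B ×ˢ A' = B ×ˢ (A ∩ A') := by
    ext p; simp only [mem_inter_iff, mem_preimage, mem_prod]; tauto
  rw [cond_apply hT, hset, hμT,
    hκ _ (hA.inter hA'') ((measure_mono inter_subset_left).trans_lt hA'.lt_top) B hB,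
    Measure.map_apply measurable_swap (hB.prod hA''), preimage_swap_prod,
    Measure.compProd_apply_prod hA'' hB, ProbabilityTheory.cond, Measure.restrict_smul,
    lintegral_smul_measure, Measure.restrict_restrict hA'', inter_comm, smul_eq_mul]

variable {Ω : Type*} [MeasurableSpace Ω]

/-- If the pairs `(Xᵢ, Yᵢ)` are independent, each with law `ν(dy) κ(dx | y)`, then the conditional
law of `(X₁, …, Xₘ)` given `(Y₁, …, Yₘ)` is `∏ᵢ κ(dxᵢ | Yᵢ)`. -/
theorem hasCondDistrib_productKernel_of_map_eq_pi {m : ℕ} {Q : Measure Ω} {X : Ω → Fin m → S₀}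
    {Y : Ω → Fin m → S₁} (hXY : Measurable fun ω i => (X ω i, Y ω i)) (ν : Measure S₁)
    [IsProbabilityMeasure ν] (κ : Kernel S₁ S₀) [IsMarkovKernel κ]
    (hQ : Q.map (fun ω i => (X ω i, Y ω i)) = Measure.pi fun _ => (ν ⊗ₘ κ).map Prod.swap) :
    HasCondDistrib X Y (productKernel κ m) Q := by
  have hswap : IsProbabilityMeasure ((ν ⊗ₘ κ).map Prod.swap) :=
    Measure.isProbabilityMeasure_map measurable_swap.aemeasurable
  have hpair : Measurable fun v : Fin m → S₀ × S₁ => ((fun i => (v i).2, fun i => (v i).1) :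
      (Fin m → S₁) × (Fin m → S₀)) := by fun_prop
  have hzip : Measurable fun p : (Fin m → S₁) × (Fin m → S₀) => fun i => (p.2 i, p.1 i) := by
    fun_prop
  have hY : Q.map Y = Measure.pi fun _ => ν := by
    have : Y = (fun v i => (v i).2) ∘ fun ω i => (X ω i, Y ω i) := rfl
    rw [this, ← Measure.map_map (by fun_prop) hXY, hQ,
      Measure.pi_map_pi (f := fun _ => Prod.snd) fun _ => measurable_snd.aemeasurable,
      Measure.map_map measurable_snd measurable_swap]
    exact congrArg Measure.pi (funext fun _ => Measure.fst_compProd ν κ)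
  have hpi : ((Measure.pi fun _ => ν) ⊗ₘ productKernel κ m).map (fun p i => (p.2 i, p.1 i)) =
      Measure.pi fun _ => (ν ⊗ₘ κ).map Prod.swap := by
    refine (Measure.pi_eq fun C hC => ?_).symm
    have hC' : ∀ i, MeasurableSet (Prod.swap ⁻¹' C i) := fun i => measurable_swap (hC i)
    rw [Measure.map_apply hzip (MeasurableSet.univ_pi hC),
      Measure.compProd_apply (hzip (MeasurableSet.univ_pi hC))]
    -- The section of a box of pairs at `y` is again a box, so the integrand is a product of
    -- functions of single coordinates.
    have hsec : ∀ y : Fin m → S₁, productKernel κ m y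
        (Prod.mk y ⁻¹' ((fun p i => (p.2 i, p.1 i)) ⁻¹' univ.pi C)) =
          ∏ i, κ (y i) (Prod.mk (y i) ⁻¹' (Prod.swap ⁻¹' C i)) := fun y => by
      rw [productKernel_apply, ← Measure.pi_pi]
      congr 1
    simp_rw [hsec]
    rw [lintegral_pi_prod_eq_prod_lintegral (fun _ => ν)
      (f := fun i y => κ y (Prod.mk y ⁻¹' (Prod.swap ⁻¹' C i)))
      fun i => Kernel.measurable_kernel_prodMk_left (hC' i)]
    refine Finset.prod_congr rfl fun i _ => ?_
    rw [Measure.map_apply measurable_swap (hC i), Measure.compProd_apply (hC' i)]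
  refine ⟨(hpair.comp hXY).aemeasurable, ?_⟩
  have : (fun ω => (Y ω, X ω)) = (fun v : Fin m → S₀ × S₁ => ((fun i => (v i).2, fun i => (v i).1) :
      (Fin m → S₁) × (Fin m → S₀))) ∘ fun ω i => (X ω i, Y ω i) := rfl
  rw [this, ← Measure.map_map hpair hXY, hQ, hY, ← hpi, Measure.map_map hpair hzip]
  exact Measure.map_id

/-- A kernel giving the conditional distribution of `X` given `Y` evaluates to the conditional
probabilities of the events `X ∈ B` given `Y`. -/
theorem ProbabilityTheory.HasCondDistrib.condExp_indicator_ae_eq {X : Ω → S₀} {Y : Ω → S₁}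
    {κ : Kernel S₁ S₀} [IsMarkovKernel κ] {Q : Measure Ω} [IsFiniteMeasure Q] (h : HasCondDistrib X Y κ Q)
    (hX : Measurable X) (hY : Measurable Y) {B : Set S₀} (hB : MeasurableSet B) :
    Q⟦X ⁻¹' B | MeasurableSpace.comap Y inferInstance⟧ =ᵐ[Q] fun ω => (κ (Y ω)).real B := by
  have hmeas : Measurable fun y => (κ y).real B := (Kernel.measurable_coe κ hB).ennreal_toReal
  symm
  refine ae_eq_condExp_of_forall_setIntegral_eq hY.comap_le ?_ ?_ ?_ ?_
  · exact (integrable_const _).indicator (hX hB)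
  · refine fun t _ _ => Integrable.integrableOn ?_
    exact .of_bound (hmeas.comp hY).aestronglyMeasurable 1
      (.of_forall fun ω => by
        rw [Real.norm_of_nonneg measureReal_nonneg]
        exact measureReal_le_one)
  · rintro _ ⟨t, ht, rfl⟩ -
    rw [integral_indicator_const _ (hX hB), measureReal_restrict_apply (hX hB), smul_eq_mul, mul_one]
    simp_rw [measureReal_def]
    rw [integral_toReal (f := fun ω => κ (Y ω) B) ((Kernel.measurable_coe κ hB).comp hY).aemeasurable
      (.of_forall fun ω => measure_lt_top _ _)]
    congr 1
    -- The defining identity of conditional expectation on `Y ⁻¹' t` is the joint law evaluated on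
    -- `t ×ˢ B`.
    have hlaw := congrArg (fun ρ => ρ (t ×ˢ B)) h.map_eq
    rw [Measure.map_apply (hY.prodMk hX) (ht.prod hB), Measure.compProd_apply_prod ht hB,
      setLIntegral_map ht (Kernel.measurable_coe κ hB) hY] at hlaw
    rw [← hlaw, inter_comm]
    rfl
  · exact (hmeas.comp (comap_measurable Y)).aestronglyMeasurable

end

/-! ### The main theorem -/

theorem mainTheorem1 {S₀ S₁ Ω : Type*} [MeasurableSpace S₀] [MeasurableSingletonClass S₀]
    [MeasurableSpace S₁] [MeasurableSingletonClass S₁] [MeasurableSpace Ω]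
    (μ : Measure (S₀ × S₁)) [SFinite μ] (P : Measure Ω) [IsProbabilityMeasure P]
    (Z : Ω → Measure (S₀ × S₁)) (hZ : IsPoissonProcess Z μ P) :
    -- the conditional measures `μ(dx | y)` exist, for one choice of kernel valid for all test sets
    (StandardBorelSpace S₀ → Nonempty S₀ →
      ∃ κ : Kernel S₁ S₀, IsMarkovKernel κ ∧ IsConditionalKernel μ κ) ∧
    -- and, for every version of them, every test set and every number of observed events,
    ∀ (κ : Kernel S₁ S₀) [IsMarkovKernel κ], IsConditionalKernel μ κ →
      ∀ A : Set S₁, MeasurableSet A → 0 < μ.snd A → μ.snd A < ∞ → ∀ m : ℕ,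
      -- `#(Y ∩ A) = m` has positive probability, and
      0 < P (observedCount Z A m) ∧
      ∀ (X : Ω → Fin m → S₀) (Y : Ω → Fin m → S₁), IsUniformLabelling P Z A m X Y →
        -- the conditional law of `(X₁, …, Xₘ)` given `(Y₁, …, Yₘ)` is `∏ᵢ μ(dxᵢ | yᵢ)`,
        HasCondDistrib X Y (productKernel κ m) P[|observedCount Z A m] ∧
        -- `X₁, …, Xₘ` are conditionally independent given `(Y₁, …, Yₘ)`,
        (∀ B : Fin m → Set S₀, (∀ i, MeasurableSet (B i)) →
          (P[|observedCount Z A m])⟦⋂ i, {ω | X ω i ∈ B i} | MeasurableSpace.comap Y inferInstance⟧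
            =ᵐ[P[|observedCount Z A m]]
          ∏ i, (P[|observedCount Z A m])⟦{ω | X ω i ∈ B i} |
            MeasurableSpace.comap Y inferInstance⟧) ∧
        -- and the conditional law of `Xᵢ` given all of `(Y₁, …, Yₘ)` is `μ(dx | Yᵢ)`
        (∀ i, HasCondDistrib (fun ω => X ω i) Y
          (κ.comap (fun y : Fin m → S₁ => y i) (measurable_pi_apply i))
          P[|observedCount Z A m]) := by
  have hcount : ∀ (A : Set S₁), MeasurableSet A → ∀ m : ℕ,
      observedCount Z A m = {ω | Z ω (Prod.snd ⁻¹' A) = m} := fun A hA m => by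
    ext ω
    simp only [observedCount, mem_ofPred_eq, Measure.snd_apply hA]
  refine ⟨fun _ _ => exists_isConditionalKernel μ, fun κ _ hκ A hA hA₀ hA' m => ?_⟩
  rw [hcount A hA m]
  have hT : MeasurableSet (Prod.snd ⁻¹' A : Set (S₀ × S₁)) := measurable_snd hA
  have hμT : μ (Prod.snd ⁻¹' A) = μ.snd A := (Measure.snd_apply hA).symm
  have hpos := hZ.measure_count_eq_pos hT (hμT ▸ hA₀.ne') (hμT ▸ hA'.ne) m
  refine ⟨hpos, fun X Y hXY => ?_⟩
  obtain ⟨W, σ, hW, hZW, hσ, hunif, hindep, hWXY⟩ := hXY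
  rw [hcount A hA m] at hZW hunif hindep
  -- Independence of `σ` from the initial labelling alone suffices.
  have hindep' := indep_of_indep_of_le_right hindep
    (show MeasurableSpace.comap W inferInstance ≤ _ by
      rw [show W = Prod.snd ∘ fun ω => (Z ω, W ω) from rfl, ← MeasurableSpace.comap_comp]
      exact MeasurableSpace.comap_mono measurable_snd.comap_le)
  have hV : (fun ω i => (X ω i, Y ω i)) = fun ω i => W ω (σ ω i) :=
    funext fun ω => funext fun i => hWXY ω i
  have hVmeas : Measurable fun ω i => (X ω i, Y ω i) := hV ▸ measurable_comp_perm hW hσ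
  have hX : Measurable X := measurable_pi_lambda _ fun i =>
    measurable_fst.comp (measurable_pi_iff.mp hVmeas i)
  have hY : Measurable Y := measurable_pi_lambda _ fun i =>
    measurable_snd.comp (measurable_pi_iff.mp hVmeas i)
  have hlaw := hZ.map_labelled_eq_pi hT (hμT ▸ hA₀.ne') (hμT ▸ hA'.ne) hW hZW hσ hunif hindep'
  rw [← hV, hκ.cond_eq_map_compProd hA hA₀.ne' hA'.ne] at hlaw
  have : IsProbabilityMeasure μ.snd[|A] := cond_isProbabilityMeasure_of_finite hA₀.ne' hA'.ne
  have : IsProbabilityMeasure P[|{ω | Z ω (Prod.snd ⁻¹' A) = m}] :=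
    cond_isProbabilityMeasure hpos.ne'
  have hjoint := hasCondDistrib_productKernel_of_map_eq_pi hVmeas μ.snd[|A] κ hlaw
  have hmarg : ∀ i, HasCondDistrib (fun ω => X ω i) Y
      (κ.comap (fun y : Fin m → S₁ => y i) (measurable_pi_apply i))
      P[|{ω | Z ω (Prod.snd ⁻¹' A) = m}] := fun i => by
    rw [← productKernel_map_eval]
    exact hjoint.comp_left (measurable_pi_apply i)
  refine ⟨hjoint, fun B hB => ?_, hmarg⟩
  have hinter : ⋂ i, {ω | X ω i ∈ B i} = X ⁻¹' univ.pi B := by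
    ext ω; simp
  rw [hinter]
  -- Both sides are evaluated through kernels: the joint one on a box, the marginal ones on its
  -- sides.
  refine (hjoint.condExp_indicator_ae_eq hX hY (MeasurableSet.univ_pi hB)).trans ?_
  have hall := ae_all_iff.mpr fun i =>
    (hmarg i).condExp_indicator_ae_eq (measurable_pi_iff.mp hX i) hY (hB i)
  filter_upwards [hall] with ω hω
  rw [Finset.prod_apply]
  have hreal : (productKernel κ m (Y ω)).real (univ.pi B) = ∏ i, (κ (Y ω i)).real (B i) := by
    simp [measureReal_def, productKernel_apply, Measure.pi_pi, ENNReal.toReal_prod]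
  rw [hreal]
  exact Finset.prod_congr rfl fun i _ => (hω i).symm
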